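/- A Runge–Kutta (RK) method with $s$ stages is given by $A\in\mathbb R^{s\times s}$ and $b\in\mathbb R^s$, with abscissas $c_i=\sum_j a_{ij}$; it is explicit if $A$ is strictly lower triangular. A step of size $h$ from $(t_0,y_0)$ for $y'=f(t,y)$ is $y_1=y_0+h\sum_i b_ik_i$ with $k_i=f\bigl(t_0+c_ih,\;y_0+h\sum_j a_{ij}k_j\bigr)$. The classical order of the method is the largest $n$ such that, for every smooth system $y'=f(t,y)$ and every solution $y$ near $t_0$, the error after one step from $(t_0,y(t_0))$ satisfies $y(t_0+h)-y_1=O(h^{n+1})$ as $h\downarrow 0$. With $\tau^{(k)}=Ac^{k-1}-\tfrac1k c^k$ (componentwise powers), $Y=\operatorname{span}\{(A^T)^jb: 0\le j\le s-1\}$ and $K_m=\operatorname{span}\{A^j\tau^{(k)}: 0\le j\le s-1,\ 1\le k\le m\}$, the weak stage order (WSO) of the method is the largest positive integer $q$ such that $K_q$ is orthogonal to $Y$; it is at least $q$ if $q\geq 1$ and $K_q$ is orthogonal to $Y$. Theorem. Let $p\ge 2$. For $\tilde c\in\mathbb R^{p+1}$ with distinct entries let $V=[\,e\,|\,\tilde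 c\,|\cdots|\,\tilde c^{\,p}\,]$, let $S\in\mathbb R^{(p+1)\times(p+1)}$ have the entries $1,\tfrac12,\dots,\tfrac1p$ on the first subdiagonal and zeros elsewhere, and let the basic method be $\tilde A=VSV^{-1}$, $\tilde b^T=e^TSV^{-1}$, where $e=(1,\dots,1)^T$. Let the parallel iterated method be the $p(p+1)$-stage method $$A=\begin{bmatrix}0\\ \tilde A&0\\ &\ddots&\ddots\\ &&\tilde A&0\end{bmatrix},\qquad b^T=\begin{bmatrix}0&\cdots&0&\tilde b^T\end{bmatrix}$$ with $p$ row and column blocks. (i) There is an explicit RK method with $p^2$ stages, classical order $p$ and weak stage order $p$; it can be taken to be the method in (ii) for a suitable choice of $\tilde c$. (ii) For every $\tilde c\in\mathbb R^{p+1}$ with distinct entries, the basic method has the abscissas $\tilde c$, and the parallel iterated method reduces, by consolidating its first $p+1$ stages into one, to a $p^2$-stage method that is explicit and has classical order $p$ and weak stage order at least $p$. (Consolidating the stages along a partition $(S_1,\dots,S_r)$ of the set of stages gives the method with coefficients $a^*_{\ell m}=\sum_{j\in S_m}a_{ij}$, which do not depend on the choice of $i\in S_\ell$, and $b^*_m=\sum_{j\in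 S_m}b_j$.) -/

import Mathlib

open scoped Matrix ContDiff Topology

/-- An `s`-stage Runge–Kutta method, given by its coefficients `(A, b)`. The abscissas are the row
sums of `A`, see `RKMethod.c`. -/
structure RKMethod (s : ℕ) where
  /-- the Butcher matrix -/
  A : Matrix (Fin s) (Fin s) ℝ
  /-- the weights -/
  b : Fin s → ℝ

namespace RKMethod

variable {s : ℕ}

/-- The abscissas `c_i = ∑_j a_{ij}`. -/
def c (M : RKMethod s) : Fin s → ℝ := fun i => ∑ j, M.A i j

/-- The method is explicit: `A` is strictly lower triangular. -/
def IsExplicit (M : RKMethod s) : Prop := ∀ i j, i ≤ j → M.A i j = 0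

/-- `k` solves the stage equations `k_i = f (t₀ + c_i h, y₀ + h ∑_j a_{ij} k_j)` of a step of size
`h` from `(t₀, y₀)` for the equation `y' = f (t, y)`. -/
def IsStages (M : RKMethod s) {E : Type*} [AddCommGroup E] [Module ℝ E]
    (f : ℝ → E → E) (t₀ : ℝ) (y₀ : E) (h : ℝ) (k : Fin s → E) : Prop :=
  ∀ i, k i = f (t₀ + M.c i * h) (y₀ + h • ∑ j, M.A i j • k j)

/-- `y₁ = y₀ + h ∑_i b_i k_i` is the result of a step of size `h` from `(t₀, y₀)`. -/
def IsStep (M : RKMethod s) {E : Type*} [AddCommGroup E] [Module ℝ E]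
    (f : ℝ → E → E) (t₀ : ℝ) (y₀ : E) (h : ℝ) (y₁ : E) : Prop :=
  ∃ k : Fin s → E, M.IsStages f t₀ y₀ h k ∧ y₁ = y₀ + h • ∑ i, M.b i • k i

/-- A step of an explicit method exists and is unique. -/
theorem IsExplicit.existsUnique_isStep {M : RKMethod s} (hM : M.IsExplicit) {E : Type*}
    [AddCommGroup E] [Module ℝ E] (f : ℝ → E → E) (t₀ : ℝ) (y₀ : E) (h : ℝ) :
    ∃! y₁, M.IsStep f t₀ y₀ h y₁ := by
  have key : ∃! k : Fin s → E, M.IsStages f t₀ y₀ h k := by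
    let F : (i : Fin s) → ((j : Fin s) → j < i → E) → E := fun i ih =>
      f (t₀ + M.c i * h) (y₀ + h • ∑ j, if hj : j < i then M.A i j • ih j hj else 0)
    refine ⟨wellFounded_lt.fix F, ?_, ?_⟩
    · intro i
      rw [WellFounded.fix_eq]
      refine congrArg (fun v => f _ (y₀ + h • v)) (Finset.sum_congr rfl fun j _ => ?_)
      by_cases hj : j < i
      · simp [hj]
      · simp [hj, hM i j (not_lt.mp hj)]
    · intro k hk
      funext i
      induction i using WellFoundedLT.induction with
      | ind i ih =>
        rw [hk i, WellFounded.fix_eq]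
        refine congrArg (fun v => f _ (y₀ + h • v)) (Finset.sum_congr rfl fun j _ => ?_)
        by_cases hj : j < i
        · simp [hj, ih j hj]
        · simp [hj, hM i j (not_lt.mp hj)]
  obtain ⟨k, hk, huniq⟩ := key
  refine ⟨_, ⟨k, hk, rfl⟩, ?_⟩
  rintro y₁ ⟨k', hk', rfl⟩
  rw [huniq k' hk']

/-- The (explicit) method has classical order at least `p`: for every smooth system
`y' = f (t, y)` and every solution `y` near `t₀`, the error after one step of size `h` from
`(t₀, y t₀)` is `O(h^(p+1))`. -/
def OrderAtLeast (M : RKMethod s) (p : ℕ) : Prop :=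
  ∀ (d : ℕ) (f : ℝ → EuclideanSpace ℝ (Fin d) → EuclideanSpace ℝ (Fin d)) (t₀ : ℝ)
    (y : ℝ → EuclideanSpace ℝ (Fin d)),
    ContDiff ℝ ∞ (fun z : ℝ × EuclideanSpace ℝ (Fin d) => f z.1 z.2) →
    (∀ᶠ t in 𝓝 t₀, HasDerivAt y (f t (y t)) t) →
    ∃ C h₀ : ℝ, 0 < h₀ ∧ ∀ h : ℝ, 0 < h → h < h₀ → ∀ y₁ : EuclideanSpace ℝ (Fin d),
      M.IsStep f t₀ (y t₀) h y₁ → ‖y (t₀ + h) - y₁‖ ≤ C * h ^ (p + 1)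

/-- The (explicit) method has classical order exactly `p`. -/
def HasOrder (M : RKMethod s) (p : ℕ) : Prop := IsGreatest {n : ℕ | M.OrderAtLeast n} p

/-- The stage order residuals `τ⁽ᵏ⁾ = A c^(k-1) - c^k / k` (powers are componentwise). It is used
for `k ≥ 1` only. -/
noncomputable def tau (M : RKMethod s) (k : ℕ) : Fin s → ℝ :=
  M.A *ᵥ (M.c ^ (k - 1)) - (1 / (k : ℝ)) • M.c ^ k

/-- The space `Y = span {b, Aᵀ b, …, (Aᵀ)^(s-1) b}`. -/
def Y (M : RKMethod s) : Submodule ℝ (Fin s → ℝ) :=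
  Submodule.span ℝ {v | ∃ j : ℕ, j < s ∧ v = (M.Aᵀ ^ j) *ᵥ M.b}

/-- The space `K_m = span {A^j τ⁽ᵏ⁾ : 0 ≤ j ≤ s - 1, 1 ≤ k ≤ m}`. -/
def K (M : RKMethod s) (m : ℕ) : Submodule ℝ (Fin s → ℝ) :=
  Submodule.span ℝ {v | ∃ j k : ℕ, j < s ∧ 1 ≤ k ∧ k ≤ m ∧ v = (M.A ^ j) *ᵥ M.tau k}

/-- The method has weak stage order at least `q`: `q` is positive and `K_q` is orthogonal
to `Y`. -/
def WSOAtLeast (M : RKMethod s) (q : ℕ) : Prop :=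
  1 ≤ q ∧ ∀ v ∈ M.K q, ∀ w ∈ M.Y, v ⬝ᵥ w = 0

/-- The method has weak stage order `q`: `q` is the largest positive integer such that `K_q` is
orthogonal to `Y`. -/
def HasWSO (M : RKMethod s) (q : ℕ) : Prop := IsGreatest {n : ℕ | M.WSOAtLeast n} q

/-- `M'` is the smaller method to which `M` reduces when, for each `m`, all the stages `j` with
`π j = m` are consolidated into the one stage `m`. -/
def IsReduction {r : ℕ} (M : RKMethod s) (π : Fin s → Fin r) (M' : RKMethod r) : Prop :=
  Function.Surjective π ∧
    (∀ i m, ∑ j with π j = m, M.A i j = M'.A (π i) m) ∧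
    ∀ m, ∑ j with π j = m, M.b j = M'.b m

end RKMethod

section ParallelIterated

/-- The `(p+1) × (p+1)` matrix `S` whose only nonzero entries are `1, 1/2, …, 1/p` on the first
subdiagonal. -/
noncomputable def sMatrix (p : ℕ) : Matrix (Fin (p + 1)) (Fin (p + 1)) ℝ :=
  Matrix.of fun i j => if (i : ℕ) = (j : ℕ) + 1 then 1 / ((i : ℕ) : ℝ) else 0

/-- The basic method with `p + 1` stages: `Ã = V S V⁻¹` and `b̃ᵀ = eᵀ S V⁻¹`, where `V` is the
Vandermonde matrix with columns `e, c̃, …, c̃^p`. -/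
noncomputable def basicMethod (p : ℕ) (ct : Fin (p + 1) → ℝ) : RKMethod (p + 1) where
  A := Matrix.vandermonde ct * sMatrix p * (Matrix.vandermonde ct)⁻¹
  b := (fun _ => 1) ᵥ* (sMatrix p * (Matrix.vandermonde ct)⁻¹)

/-- The parallel iterated method with `p` blocks of `p + 1` stages, which has `Ã` in the blocks on
the first block subdiagonal, zero in all the other blocks, and weights `(0, …, 0, b̃)`. The stage
`i` is number `i % (p + 1)` in the block number `i / (p + 1)`. -/
noncomputable def parallelIterated (p : ℕ) (ct : Fin (p + 1) → ℝ) : RKMethod (p * (p + 1)) where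
  A := Matrix.of fun i j =>
    if (i.divNat : ℕ) = (j.divNat : ℕ) + 1 then (basicMethod p ct).A i.modNat j.modNat else 0
  b := fun i => if (i.divNat : ℕ) + 1 = p then (basicMethod p ct).b i.modNat else 0

/-- The map from the stages of the `p (p + 1)`-stage method to the `p²` consolidated stages: the
first `p + 1` stages go to the stage `0`, the stage `p + i` goes to the stage `i`. -/
def consolidate (p : ℕ) (j : Fin (p * (p + 1))) : Fin (p ^ 2) :=
  ⟨(j : ℕ) - p, by
    have hj := j.isLt
    have h0 : 0 < p := by
      rcases Nat.eq_zero_or_pos p with h | h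
      · subst h
        simp at hj
      · exact h
    have h1 : 0 < p ^ 2 := by positivity
    have h2 : p * (p + 1) = p ^ 2 + p := by ring
    omega⟩

/-- The last one among the stages of the `p (p + 1)`-stage method that are consolidated into the
stage `i`. -/
def representative (p : ℕ) (i : Fin (p ^ 2)) : Fin (p * (p + 1)) :=
  ⟨(i : ℕ) + p, by
    have hi := i.isLt
    have h2 : p * (p + 1) = p ^ 2 + p := by ring
    omega⟩

/-- The `p²`-stage method obtained from the parallel iterated method by consolidating its first
`p + 1` stages. -/
noncomputable def reducedMethod (p : ℕ) (ct : Fin (p + 1) → ℝ) : RKMethod (p ^ 2) where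
  A := Matrix.of fun i m =>
    ∑ j with consolidate p j = m, (parallelIterated p ct).A (representative p i) j
  b := fun m => ∑ j with consolidate p j = m, (parallelIterated p ct).b j

end ParallelIterated

/-! The identity `Ã V = V S` says that `Ã` integrates: it sends `c̃^k` to `c̃^(k+1)/(k+1)` for `k <
p` and kills `c̃^p`. Likewise `b̃` integrates `c̃^k` over `[0, 1]` for `k < p` and kills `c̃^p`.
Order: the parallel iterated method is a discrete Picard iteration started from the constant slope
`f (t₀, y₀)`. Each block gains one power of `h` (`isBigO_parallelIterated_stages`), so the last
block has slopes correct up to `O(h^p)`, and the final quadrature costs only `O(h^(p+1))`. The order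
is not higher, since `b̃ᵀ c̃^p = 0` instead of `1/(p+1)`. Weak stage order: `τ⁽¹⁾ = 0`, and for `2 ≤
k ≤ p` the residual `τ⁽ᵏ⁾` is `-c̃^k/k` in block 1 and zero elsewhere. `A^n` moves it to block `n +
1`, and `b` sees only block `p - 1`, so the sole survivor has `n = p - 2`. It is a multiple of `b̃ᵀ
Ã^n c̃^k` with `n + k ≥ p`, which vanishes because the degree reaches `p` and is then killed
(`basicMethod_b_dotProduct_pow_mulVec`). For `k = p + 1` one gets a nonzero multiple of `b̃ᵀ
c̃^(p+1)`, which is nonzero for the nodes `-1, …, -(p+1)`. The stages of block 0 coincide, and order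
and the numbers `bᵀ A^n τ⁽ᵏ⁾` pass through their consolidation. -/

/-! ### Local expansions, smoothness of solutions and quadrature errors. -/

section Expansion

open Asymptotics Filter

variable {E : Type*} [NormedAddCommGroup E] [NormedSpace ℝ E]

/-- If the derivative of `F` is `O(xⁿ)` at `0`, then `F x - F 0 = O(xⁿ⁺¹)`. -/
theorem isBigO_sub_of_hasDerivAt {F F' : ℝ → E} {n : ℕ}
    (hF : ∀ᶠ x in 𝓝 0, HasDerivAt F (F' x) x) (hF' : F' =O[𝓝 0] fun x : ℝ => x ^ n) :
    (fun x => F x - F 0) =O[𝓝 0] fun x : ℝ => x ^ (n + 1) := by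
  obtain ⟨C, hC⟩ := hF'.bound
  obtain ⟨ε, hε, hball⟩ := Metric.eventually_nhds_iff.mp (hF.and hC)
  refine IsBigO.of_bound C (Metric.eventually_nhds_iff.mpr ⟨ε, hε, fun x hx => ?_⟩)
  have hx' : |x| < ε := by simpa using hx
  have hmem : ∀ t ∈ Set.Icc (-|x|) |x|, |t| ≤ |x| := fun t ht => abs_le.mpr ht
  have hC0 : 0 ≤ C * |x| ^ n := by
    have h1 := (hball hx).2
    rw [norm_pow, Real.norm_eq_abs] at h1
    exact (norm_nonneg _).trans h1
  -- Mean value inequality on `[-|x|, |x|]`, which contains `0` and `x` whatever the sign of `x`.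
  have key := Convex.norm_image_sub_le_of_norm_hasDerivWithin_le (f := F) (f' := F') (C := C * |x| ^ n)
    (s := Set.Icc (-|x|) |x|) (x := 0) (y := x)
    (fun t ht => (hball (by simpa using (hmem t ht).trans_lt hx')).1.hasDerivWithinAt)
    (fun t ht => by
      have h1 := (hball (y := t) (by simpa using (hmem t ht).trans_lt hx')).2
      rw [norm_pow, Real.norm_eq_abs] at h1
      -- The constant from `IsBigO.bound` may be negative, and then monotonicity of `t ↦ C * |t| ^
      -- n` fails.
      rcases le_or_gt 0 C with hC | hC
      · exact h1.trans (mul_le_mul_of_nonneg_left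
          (pow_le_pow_left₀ (abs_nonneg t) (hmem t ht) n) hC)
      · exact (h1.trans (mul_nonpos_of_nonpos_of_nonneg hC.le (by positivity))).trans hC0)
    (convex_Icc _ _) (by simp) ⟨neg_abs_le x, le_abs_self x⟩
  rw [norm_pow, Real.norm_eq_abs, pow_succ, ← mul_assoc]
  simpa using key

/-- A polynomial expansion of the derivative can be integrated. -/
theorem isBigO_sub_sum_of_hasDerivAt {F F' : ℝ → E} {n : ℕ} {a : ℕ → E}
    (hF : ∀ᶠ x in 𝓝 0, HasDerivAt F (F' x) x)
    (ha : (fun x => F' x - ∑ k ∈ Finset.range n, x ^ k • a k) =O[𝓝 0] fun x : ℝ => x ^ n) :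
    (fun x => F x - F 0 - ∑ k ∈ Finset.range n, (x ^ (k + 1) / ((k : ℝ) + 1)) • a k)
      =O[𝓝 0] fun x : ℝ => x ^ (n + 1) := by
  have hd : ∀ᶠ x in 𝓝 0, HasDerivAt
      (fun x => F x - ∑ k ∈ Finset.range n, (x ^ (k + 1) / ((k : ℝ) + 1)) • a k)
      (F' x - ∑ k ∈ Finset.range n, x ^ k • a k) x := by
    filter_upwards [hF] with x hx
    refine hx.sub (HasDerivAt.fun_sum fun k _ => ?_)
    have h1 : HasDerivAt (fun x : ℝ => x ^ (k + 1) / ((k : ℝ) + 1)) (x ^ k) x := by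
      have h2 := (hasDerivAt_pow (k + 1) x).div_const ((k : ℝ) + 1)
      refine h2.congr_deriv ?_
      have : (k : ℝ) + 1 ≠ 0 := by positivity
      push_cast
      field_simp
    exact h1.smul_const _
  refine (isBigO_sub_of_hasDerivAt hd ha).congr_left fun x => ?_
  simp [sub_right_comm]

/-- A function that is `Cⁿ` at `0` has a polynomial expansion with remainder `O(xⁿ)` there. -/
theorem ContDiffAt.exists_isBigO_sub_sum {n : ℕ} {g : ℝ → E} (hg : ContDiffAt ℝ n g 0) :
    ∃ a : ℕ → E,
      (fun x => g x - ∑ k ∈ Finset.range n, x ^ k • a k) =O[𝓝 0] fun x : ℝ => x ^ n := by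
  induction n generalizing g with
  | zero =>
    refine ⟨0, ?_⟩
    simpa using hg.continuousAt.norm.isBoundedUnder_le.isBigO_one ℝ
  | succ n ih =>
    obtain ⟨g', ⟨u, hu, hd⟩, hg'⟩ := contDiffAt_succ_iff_hasFDerivAt.mp
      (by exact_mod_cast hg : ContDiffAt ℝ ((n : WithTop ℕ∞) + 1) g 0)
    obtain ⟨a, ha⟩ := ih (hg'.clm_apply (contDiffAt_const (c := (1 : ℝ))))
    have h1 : ∀ᶠ x in 𝓝 0, HasDerivAt g (g' x 1) x := by
      filter_upwards [hu] with x hx using (hd x hx).hasDerivAt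
    refine ⟨fun k => k.casesOn (g 0) fun k => ((k : ℝ) + 1)⁻¹ • a k, ?_⟩
    refine (isBigO_sub_sum_of_hasDerivAt h1 ha).congr_left fun x => ?_
    rw [Finset.sum_range_succ']
    simp only [pow_zero, one_smul, smul_smul, div_eq_mul_inv]
    exact (sub_add_eq_sub_sub_swap _ _ _).symm

/-- A solution of a smooth differential equation is smooth. -/
theorem ContDiffAt.of_eventually_hasDerivAt {f : ℝ → E → E} {y : ℝ → E} {t₀ : ℝ}
    (hf : ContDiff ℝ ∞ fun z : ℝ × E => f z.1 z.2)
    (hy : ∀ᶠ t in 𝓝 t₀, HasDerivAt y (f t (y t)) t) (n : ℕ) : ContDiffAt ℝ n y t₀ := by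
  induction n with
  | zero =>
    obtain ⟨u, hu, huo, h0⟩ := eventually_nhds_iff.mp hy
    refine (contDiffAt_zero (𝕜 := ℝ)).mpr ⟨u, huo.mem_nhds h0, fun t ht => ?_⟩
    exact (hu t ht).continuousAt.continuousWithinAt
  | succ n ih =>
    -- Bootstrapping: if `y` is `Cⁿ`, so is its derivative `f t (y t)`.
    have h1 : ContDiffAt ℝ n (fun t => f t (y t)) t₀ :=
      ContDiffAt.comp (g := fun z : ℝ × E => f z.1 z.2) t₀
        (hf.of_le (by exact_mod_cast le_top)).contDiffAt (contDiffAt_id.prodMk ih)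
    refine contDiffAt_succ_iff_hasFDerivAt.mpr
      ⟨fun t => ContinuousLinearMap.toSpanSingleton ℝ (f t (y t)),
        ⟨_, hy, fun t ht => HasDerivAt.hasFDerivAt ht⟩, ?_⟩
    exact (ContinuousLinearMap.toSpanSingletonCLE (𝕜 := ℝ) (E := E)).contDiff.contDiffAt.comp t₀ h1

/-- Quadrature with weights `h w_j` and nodes `h c_j` that is exact on `[0, γ h]` for polynomials
of degree less than `n` has the error `O(hⁿ⁺¹)`. -/
theorem isBigO_quadrature {ι : Type*} [Fintype ι] {F g : ℝ → E} {n : ℕ}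
    (hF : ∀ᶠ x in 𝓝 0, HasDerivAt F (g x) x) (hg : ContDiffAt ℝ n g 0)
    (w c : ι → ℝ) (γ : ℝ)
    (hw : ∀ k < n, ∑ j, w j * c j ^ k = γ ^ (k + 1) / ((k : ℝ) + 1)) :
    (fun h => F (γ * h) - F 0 - h • ∑ j, w j • g (c j * h)) =O[𝓝 0] fun h : ℝ => h ^ (n + 1) := by
  obtain ⟨a, ha⟩ := hg.exists_isBigO_sub_sum
  have hA := isBigO_sub_sum_of_hasDerivAt hF ha
  have tend : ∀ r : ℝ, Tendsto (fun h : ℝ => r * h) (𝓝 0) (𝓝 0) := fun r => by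
    simpa using (continuous_const_mul r).tendsto 0
  have scale : ∀ (r : ℝ) (m : ℕ), (fun h : ℝ => (r * h) ^ m) =O[𝓝 0] fun h : ℝ => h ^ m :=
    fun r m => by
      simp only [mul_pow]
      exact isBigO_const_mul_self _ _ _
  have h1 := (hA.comp_tendsto (tend γ)).trans (scale γ (n + 1))
  have h2 : (fun h : ℝ => h • ∑ j, w j • (g (c j * h) -
      ∑ k ∈ Finset.range n, (c j * h) ^ k • a k)) =O[𝓝 0] fun h : ℝ => h ^ (n + 1) := by
    simp only [pow_succ']
    refine (isBigO_refl (fun h : ℝ => h) _).smul (IsBigO.fun_sum fun j _ => ?_)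
    exact ((ha.comp_tendsto (tend (c j))).trans (scale (c j) n)).const_smul_left _
  refine (h1.sub h2).congr_left fun h => ?_
  -- Exactness `hw` makes the polynomial parts of quadrature and integral cancel; only the two
  -- remainders are left.
  have h3 : h • ∑ j, w j • ∑ k ∈ Finset.range n, (c j * h) ^ k • a k =
      ∑ k ∈ Finset.range n, ((γ * h) ^ (k + 1) / ((k : ℝ) + 1)) • a k := by
    simp only [Finset.smul_sum, smul_smul]
    rw [Finset.sum_comm]
    refine Finset.sum_congr rfl fun k hk => ?_
    rw [← Finset.sum_smul]
    congr 1
    rw [mul_pow, mul_div_right_comm, ← hw k (Finset.mem_range.mp hk), Finset.sum_mul]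
    refine Finset.sum_congr rfl fun j _ => ?_
    ring
  simp only [Function.comp_apply, smul_sub, Finset.sum_sub_distrib, h3]
  abel

/-- A locally Lipschitz right-hand side preserves the order of approximation. -/
theorem isBigO_rhs_sub {f : ℝ → E → E} {t₀ : ℝ} {y₀ : E}
    (hf : ContDiffAt ℝ 1 (fun z : ℝ × E => f z.1 z.2) (t₀, y₀)) {l : Filter ℝ}
    {t : ℝ → ℝ} {u v : ℝ → E} {r : ℝ → ℝ} (ht : Tendsto t l (𝓝 t₀)) (hv : Tendsto v l (𝓝 y₀))
    (huv : (fun h => u h - v h) =O[l] r) (hr : Tendsto r l (𝓝 0)) :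
    (fun h => f (t h) (u h) - f (t h) (v h)) =O[l] r := by
  obtain ⟨K, U, hU, hK⟩ := hf.exists_lipschitzOnWith
  have hu : Tendsto u l (𝓝 y₀) := by
    simpa using (huv.trans_tendsto hr).add hv
  refine IsBigO.trans (IsBigO.of_bound K ?_) huv
  filter_upwards [(ht.prodMk_nhds hu) hU, (ht.prodMk_nhds hv) hU] with h h1 h2
  have := hK.norm_sub_le h1 h2
  simpa using this

end Expansion

namespace RKMethod

variable {s r : ℕ}

/-! ### Consolidation of stages. -/

section Reduction

variable {M : RKMethod s} {M' : RKMethod r} {π : Fin s → Fin r}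

theorem IsReduction.sum_A_smul (hM : M.IsReduction π M') {E : Type*} [AddCommGroup E] [Module ℝ E]
    (i : Fin s) (k : Fin r → E) :
    ∑ m, M'.A (π i) m • k m = ∑ j, M.A i j • k (π j) := by
  rw [← Finset.sum_fiberwise (s := Finset.univ) (g := π)]
  refine Finset.sum_congr rfl fun m _ => ?_
  rw [← hM.2.1 i m, Finset.sum_smul]
  exact Finset.sum_congr rfl fun j hj => by rw [(Finset.mem_filter.mp hj).2]

theorem IsReduction.sum_b_smul (hM : M.IsReduction π M') {E : Type*} [AddCommGroup E] [Module ℝ E]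
    (k : Fin r → E) : ∑ m, M'.b m • k m = ∑ j, M.b j • k (π j) := by
  rw [← Finset.sum_fiberwise (s := Finset.univ) (g := π)]
  refine Finset.sum_congr rfl fun m _ => ?_
  rw [← hM.2.2 m, Finset.sum_smul]
  exact Finset.sum_congr rfl fun j hj => by rw [(Finset.mem_filter.mp hj).2]

theorem IsReduction.c_apply (hM : M.IsReduction π M') (i : Fin s) : M'.c (π i) = M.c i := by
  simpa [c] using hM.sum_A_smul i (fun _ => (1 : ℝ))

theorem IsReduction.c_comp (hM : M.IsReduction π M') : M'.c ∘ π = M.c := funext hM.c_apply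

/-- A step with the reduced method is a step with the original method. -/
theorem IsReduction.isStep (hM : M.IsReduction π M') {E : Type*} [AddCommGroup E] [Module ℝ E]
    {f : ℝ → E → E} {t₀ h : ℝ} {y₀ y₁ : E} (hy : M'.IsStep f t₀ y₀ h y₁) :
    M.IsStep f t₀ y₀ h y₁ := by
  obtain ⟨k, hk, rfl⟩ := hy
  refine ⟨k ∘ π, fun i => ?_, ?_⟩
  · simpa [hM.c_apply, hM.sum_A_smul] using hk (π i)
  · simp [hM.sum_b_smul]

theorem IsReduction.orderAtLeast (hM : M.IsReduction π M') {p : ℕ} (h : M.OrderAtLeast p) :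
    M'.OrderAtLeast p := by
  intro d f t₀ y hf hy
  obtain ⟨C, h₀, hh₀, H⟩ := h d f t₀ y hf hy
  exact ⟨C, h₀, hh₀, fun h h1 h2 y₁ hy₁ => H h h1 h2 y₁ (hM.isStep hy₁)⟩

/-- Vectors constant on the classes of `π` form an invariant subspace of `M.A`, on which it acts as
`M'.A`. Hence the weak stage order conditions can be tested on the large method. -/
theorem IsReduction.mulVec_comp (hM : M.IsReduction π M') (v : Fin r → ℝ) :
    (M'.A *ᵥ v) ∘ π = M.A *ᵥ (v ∘ π) :=
  funext fun i => by simpa [Matrix.mulVec, dotProduct] using hM.sum_A_smul i v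

theorem IsReduction.pow_mulVec_comp (hM : M.IsReduction π M') (n : ℕ) (v : Fin r → ℝ) :
    (M'.A ^ n *ᵥ v) ∘ π = M.A ^ n *ᵥ (v ∘ π) := by
  induction n with
  | zero => simp
  | succ n ih => simp only [pow_succ', ← Matrix.mulVec_mulVec, hM.mulVec_comp, ih]

theorem IsReduction.b_dotProduct (hM : M.IsReduction π M') (v : Fin r → ℝ) :
    M'.b ⬝ᵥ v = M.b ⬝ᵥ (v ∘ π) := by
  simpa [dotProduct] using hM.sum_b_smul v

theorem IsReduction.tau_comp (hM : M.IsReduction π M') (k : ℕ) : M'.tau k ∘ π = M.tau k := by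
  have h1 : ∀ n : ℕ, (M'.c ^ n) ∘ π = M.c ^ n := fun n => by
    rw [← hM.c_comp]
    rfl
  have h2 := hM.mulVec_comp (M'.c ^ (k - 1))
  rw [h1] at h2
  funext i
  have h3 := congrFun h2 i
  have h4 := congrFun (h1 k) i
  simp only [Function.comp_apply] at h3 h4
  simp [tau, h3, hM.c_apply]

end Reduction

/-! ### Scalar conditions for weak stage order and order. -/

/-- By bilinearity it suffices to pair generators, and moving the transposes across the dot product
merges the two powers of `A` into one. -/
theorem wsoAtLeast_of_forall {M : RKMethod s} {q : ℕ} (hq : 1 ≤ q)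
    (h : ∀ n k : ℕ, 1 ≤ k → k ≤ q → M.b ⬝ᵥ (M.A ^ n *ᵥ M.tau k) = 0) : M.WSOAtLeast q := by
  refine ⟨hq, fun v hv w hw => ?_⟩
  induction hv using Submodule.span_induction with
  | zero => simp
  | add x y _ _ hx hy => rw [add_dotProduct, hx, hy, add_zero]
  | smul a x _ hx => rw [smul_dotProduct, hx, smul_zero]
  | mem v hv =>
    obtain ⟨j, k, -, hk, hkq, rfl⟩ := hv
    induction hw using Submodule.span_induction with
    | zero => simp
    | add x y _ _ hx hy => rw [dotProduct_add, hx, hy, add_zero]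
    | smul a x _ hx => rw [dotProduct_smul, hx, smul_zero]
    | mem w hw =>
      obtain ⟨i, -, rfl⟩ := hw
      rw [← Matrix.transpose_pow, Matrix.mulVec_transpose, dotProduct_comm,
        ← Matrix.dotProduct_mulVec, Matrix.mulVec_mulVec, ← pow_add]
      exact h _ k hk hkq

theorem WSOAtLeast.b_dotProduct_tau {M : RKMethod s} {q k : ℕ} (hM : M.WSOAtLeast q) (hs : 0 < s)
    (hk : 1 ≤ k) (hkq : k ≤ q) : M.b ⬝ᵥ M.tau k = 0 := by
  rw [dotProduct_comm]
  exact hM.2 _ (Submodule.subset_span ⟨0, k, hs, hk, hkq, by simp⟩)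
    _ (Submodule.subset_span ⟨0, hs, by simp⟩)

/-- A method of order `n` integrates the monomials of degree less than `n` exactly. -/
theorem OrderAtLeast.sum_b_mul_c_pow {M : RKMethod s} {n k : ℕ} (hM : M.OrderAtLeast n)
    (hE : M.IsExplicit) (hk : k < n) : ∑ j, M.b j * M.c j ^ k = 1 / ((k : ℝ) + 1) := by
  let e : EuclideanSpace ℝ (Fin 1) := EuclideanSpace.single 0 1
  have he : ‖e‖ = 1 := by simp [e]
  -- Test equation `y' = (k+1) t^k` with solution `t^(k+1)`: the right-hand side does not depend on
  -- `y`, so a step from `0` is pure quadrature and its error is exactly `h^(k+1) δ`.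
  obtain ⟨C, h₀, hh₀, H⟩ := hM 1 (fun t _ => (((k : ℝ) + 1) * t ^ k) • e) 0
    (fun t => t ^ (k + 1) • e) (by fun_prop)
    (Filter.Eventually.of_forall fun t => by
      simpa using (hasDerivAt_pow (k + 1) t).smul_const e)
  set δ : ℝ := 1 - ((k : ℝ) + 1) * ∑ j, M.b j * M.c j ^ k with hδ
  have bound : ∀ h : ℝ, 0 < h → h < h₀ → |δ| ≤ C * h ^ (n - k) := by
    intro h h1 h2
    obtain ⟨y₁, hy₁, -⟩ := hE.existsUnique_isStep
      (fun t (_ : EuclideanSpace ℝ (Fin 1)) => (((k : ℝ) + 1) * t ^ k) • e) 0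
      ((0 : ℝ) ^ (k + 1) • e) h
    have h3 := H h h1 h2 y₁ hy₁
    obtain ⟨κ, hκ, rfl⟩ := hy₁
    have h4 : (0 + h) ^ (k + 1) • e - ((0 : ℝ) ^ (k + 1) • e + h • ∑ i, M.b i • κ i) =
        (h ^ (k + 1) * δ) • e := by
      have h5 : ∀ i, κ i = (((k : ℝ) + 1) * (M.c i * h) ^ k) • e := fun i => by
        simpa using hκ i
      simp only [h5, smul_smul, ← Finset.sum_smul, zero_add, zero_pow (Nat.succ_ne_zero k),
        zero_smul, ← sub_smul, hδ]
      congr 1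
      rw [mul_sub, mul_one, Finset.mul_sum, Finset.mul_sum, Finset.mul_sum]
      congr 1
      refine Finset.sum_congr rfl fun i _ => ?_
      ring
    rw [h4, norm_smul, he, mul_one, norm_mul, Real.norm_of_nonneg (by positivity),
      Real.norm_eq_abs, show n + 1 = (k + 1) + (n - k) by omega, pow_add h (k + 1) (n - k),
      mul_left_comm] at h3
    exact le_of_mul_le_mul_left h3 (by positivity)
  have hlim : Filter.Tendsto (fun h : ℝ => C * h ^ (n - k)) (𝓝[>] 0) (𝓝 0) := by
    have : Continuous fun h : ℝ => C * h ^ (n - k) := by fun_prop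
    simpa [zero_pow (Nat.sub_ne_zero_of_lt hk)] using
      (this.tendsto 0).mono_left nhdsWithin_le_nhds
  have hle : |δ| ≤ 0 := by
    refine ge_of_tendsto hlim ?_
    filter_upwards [Ioo_mem_nhdsGT hh₀] with h hh using bound h hh.1 hh.2
  have hδ0 : δ = 0 := abs_nonpos_iff.mp hle
  have : (k : ℝ) + 1 ≠ 0 := by positivity
  rw [eq_div_iff this]
  linarith

end RKMethod

/-! ### The basic method as an integration operator on powers of the nodes. -/

section Basic

variable {p : ℕ} {ct : Fin (p + 1) → ℝ}

theorem isUnit_det_vandermonde (hct : Function.Injective ct) :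
    IsUnit (Matrix.vandermonde ct).det :=
  isUnit_iff_ne_zero.mpr (Matrix.det_vandermonde_ne_zero_iff.mpr hct)

theorem basicMethod_A_mul_vandermonde (hct : Function.Injective ct) :
    (basicMethod p ct).A * Matrix.vandermonde ct = Matrix.vandermonde ct * sMatrix p := by
  rw [basicMethod, Matrix.mul_assoc, Matrix.nonsing_inv_mul _ (isUnit_det_vandermonde hct),
    Matrix.mul_one]

theorem basicMethod_b_vecMul_vandermonde (hct : Function.Injective ct) :
    (basicMethod p ct).b ᵥ* Matrix.vandermonde ct = (fun _ => 1) ᵥ* sMatrix p := by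
  rw [basicMethod, Matrix.vecMul_vecMul, Matrix.mul_assoc,
    Matrix.nonsing_inv_mul _ (isUnit_det_vandermonde hct), Matrix.mul_one]

theorem sum_mul_sMatrix_of_lt (g : ℕ → ℝ) {k : ℕ} (hk : k < p) :
    ∑ i : Fin (p + 1), g i * sMatrix p i ⟨k, by omega⟩ = g (k + 1) / ((k : ℝ) + 1) := by
  rw [Finset.sum_eq_single ⟨k + 1, by omega⟩]
  · simp [sMatrix, div_eq_mul_inv]
  · intro i _ hi
    have : (i : ℕ) ≠ k + 1 := fun h => hi (Fin.ext h)
    simp [sMatrix, this]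
  · simp

theorem sum_mul_sMatrix_last (g : ℕ → ℝ) :
    ∑ i : Fin (p + 1), g i * sMatrix p i ⟨p, by omega⟩ = 0 :=
  Finset.sum_eq_zero fun i _ => by
    have : (i : ℕ) ≠ p + 1 := by omega
    simp [sMatrix, this]

theorem basicMethod_sum_A_mul_pow (hct : Function.Injective ct) (i : Fin (p + 1)) {k : ℕ}
    (hk : k < p) :
    ∑ j, (basicMethod p ct).A i j * ct j ^ k = ct i ^ (k + 1) / ((k : ℝ) + 1) := by
  have h := congrFun (congrFun (basicMethod_A_mul_vandermonde hct) i) ⟨k, by omega⟩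
  simp only [Matrix.mul_apply, Matrix.vandermonde_apply] at h
  rw [h, sum_mul_sMatrix_of_lt (fun m => ct i ^ m) hk]

theorem basicMethod_A_mulVec_pow (hct : Function.Injective ct) {k : ℕ} (hk : k < p) :
    (basicMethod p ct).A *ᵥ ct ^ k = (1 / ((k : ℝ) + 1)) • ct ^ (k + 1) :=
  funext fun i => by
    simpa [Matrix.mulVec, dotProduct, div_eq_inv_mul] using basicMethod_sum_A_mul_pow hct i hk

theorem basicMethod_A_mulVec_pow_last (hct : Function.Injective ct) :
    (basicMethod p ct).A *ᵥ ct ^ p = 0 := by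
  funext i
  have h := congrFun (congrFun (basicMethod_A_mul_vandermonde hct) i) ⟨p, by omega⟩
  simp only [Matrix.mul_apply, Matrix.vandermonde_apply] at h
  rw [sum_mul_sMatrix_last (fun m => ct i ^ m)] at h
  simpa [Matrix.mulVec, dotProduct] using h

theorem basicMethod_sum_b_mul_pow (hct : Function.Injective ct) {k : ℕ} (hk : k < p) :
    ∑ j, (basicMethod p ct).b j * ct j ^ k = 1 / ((k : ℝ) + 1) := by
  have h := congrFun (basicMethod_b_vecMul_vandermonde hct) ⟨k, by omega⟩
  simp only [Matrix.vecMul, dotProduct, Matrix.vandermonde_apply] at h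
  rw [h, sum_mul_sMatrix_of_lt (fun _ => 1) hk]

theorem basicMethod_sum_b_mul_pow_last (hct : Function.Injective ct) :
    ∑ j, (basicMethod p ct).b j * ct j ^ p = 0 := by
  have h := congrFun (basicMethod_b_vecMul_vandermonde hct) ⟨p, by omega⟩
  simp only [Matrix.vecMul, dotProduct, Matrix.vandermonde_apply] at h
  rw [h, sum_mul_sMatrix_last (fun _ => 1)]

theorem basicMethod_c (hp : 0 < p) (hct : Function.Injective ct) : (basicMethod p ct).c = ct :=
  funext fun i => by simpa [RKMethod.c] using basicMethod_sum_A_mul_pow hct i hp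

/-- Each factor `Ã` trades one unit of `n` for one unit of `k`, so `n + k ≥ p` persists. On reaching
degree `p` the vector is killed by the next `Ã`, or by `b̃` if none is left. -/
theorem basicMethod_b_dotProduct_pow_mulVec (hct : Function.Injective ct) {n k : ℕ} (hk : k ≤ p)
    (hn : p ≤ n + k) :
    (basicMethod p ct).b ⬝ᵥ ((basicMethod p ct).A ^ n *ᵥ ct ^ k) = 0 := by
  induction n generalizing k with
  | zero =>
    obtain rfl : k = p := by omega
    simpa [dotProduct] using basicMethod_sum_b_mul_pow_last hct
  | succ n ih =>
    rw [pow_succ, ← Matrix.mulVec_mulVec]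
    rcases hk.eq_or_lt with rfl | hk
    · simp [basicMethod_A_mulVec_pow_last hct]
    · rw [basicMethod_A_mulVec_pow hct hk, Matrix.mulVec_smul, dotProduct_smul,
        ih hk (by omega), smul_zero]

/-- For suitable (negative) nodes the weights of the basic method do not annihilate the monomial of
degree `p + 1`. -/
theorem exists_basicMethod_sum_b_mul_pow_ne_zero (hp : 0 < p) :
    ∃ ct : Fin (p + 1) → ℝ, Function.Injective ct ∧
      ∑ j, (basicMethod p ct).b j * ct j ^ (p + 1) ≠ 0 := by
  let ct : Fin (p + 1) → ℝ := fun i => -((i : ℝ) + 1)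
  have hct : Function.Injective ct := fun i j hij => by
    have : (i : ℝ) = j := by simpa [ct] using hij
    exact Fin.ext (by exact_mod_cast this)
  refine ⟨ct, hct, ?_⟩
  -- The node polynomial. Taking it over `ℕ` makes its coefficients nonnegative for free; at the
  -- nodes it expresses `c̃^(p+1)` by lower powers, so `b̃ᵀ c̃^(p+1)` is minus a positive sum.
  let Q : Polynomial ℕ := ∏ i : Fin (p + 1), (Polynomial.X + Polynomial.C ((i : ℕ) + 1))
  have hmonic : Q.Monic := Polynomial.monic_prod_of_monic _ _ fun i _ =>
    Polynomial.monic_X_add_C _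
  have hdeg : Q.natDegree = p + 1 := by
    rw [Polynomial.natDegree_prod_of_monic _ _ fun i _ => Polynomial.monic_X_add_C _]
    simp only [Polynomial.natDegree_X_add_C]
    simp
  have hroot : ∀ j, ∑ m ∈ Finset.range (p + 2), (Q.coeff m : ℝ) * ct j ^ m = 0 := by
    intro j
    have h1 : Polynomial.eval₂ (Nat.castRingHom ℝ) (ct j) Q = 0 := by
      rw [Polynomial.eval₂_finsetProd]
      refine Finset.prod_eq_zero (Finset.mem_univ j) ?_
      simp [ct]
    rw [Polynomial.eval₂_eq_sum_range, hdeg] at h1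
    simpa using h1
  have hpow : ∀ j, ct j ^ (p + 1) = -∑ m ∈ Finset.range (p + 1), (Q.coeff m : ℝ) * ct j ^ m := by
    intro j
    have h1 := hroot j
    have h2 : Q.coeff (p + 1) = 1 := hdeg ▸ hmonic.coeff_natDegree
    rw [Finset.sum_range_succ, h2] at h1
    push_cast at h1
    linarith
  have hsum : ∑ j, (basicMethod p ct).b j * ct j ^ (p + 1) =
      -∑ m ∈ Finset.range p, (Q.coeff m : ℝ) * (1 / ((m : ℝ) + 1)) := by
    simp only [hpow, mul_neg, Finset.mul_sum, Finset.sum_neg_distrib]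
    rw [Finset.sum_comm, Finset.sum_range_succ]
    have h1 : ∀ m, ∑ j, (basicMethod p ct).b j * ((Q.coeff m : ℝ) * ct j ^ m) =
        Q.coeff m * ∑ j, (basicMethod p ct).b j * ct j ^ m := fun m => by
      rw [Finset.mul_sum]
      exact Finset.sum_congr rfl fun j _ => by ring
    simp only [h1]
    rw [basicMethod_sum_b_mul_pow_last hct, mul_zero, add_zero]
    congr 1
    exact Finset.sum_congr rfl fun m hm => by
      rw [basicMethod_sum_b_mul_pow hct (Finset.mem_range.mp hm)]
  have hQ0 : (0 : ℝ) < Q.coeff 0 := by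
    rw [Polynomial.coeff_zero_prod]
    simp only [Polynomial.coeff_add, Polynomial.coeff_X_zero, Polynomial.coeff_C_zero, zero_add]
    exact_mod_cast Finset.prod_pos fun i _ => Nat.succ_pos _
  have hpos : 0 < ∑ m ∈ Finset.range p, (Q.coeff m : ℝ) * (1 / ((m : ℝ) + 1)) :=
    Finset.sum_pos' (fun m _ => by positivity) ⟨0, Finset.mem_range.mpr hp, by simpa using hQ0⟩
  rw [hsum]
  exact (neg_neg_of_pos hpos).ne

end Basic

/-! ### The parallel iterated method: order and residuals, block by block. -/

section Parallel

open Asymptotics Filter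

variable {p : ℕ} {ct : Fin (p + 1) → ℝ}

theorem parallelIterated_A_apply (a b : Fin p) (i j : Fin (p + 1)) :
    (parallelIterated p ct).A (finProdFinEquiv (a, i)) (finProdFinEquiv (b, j)) =
      if (a : ℕ) = b + 1 then (basicMethod p ct).A i j else 0 := by
  have h1 := finProdFinEquiv.symm_apply_apply (a, i)
  have h2 := finProdFinEquiv.symm_apply_apply (b, j)
  simp only [finProdFinEquiv_symm_apply, Prod.mk.injEq] at h1 h2
  simp only [parallelIterated, Matrix.of_apply, h1, h2]

theorem parallelIterated_b_apply (a : Fin p) (i : Fin (p + 1)) :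
    (parallelIterated p ct).b (finProdFinEquiv (a, i)) =
      if (a : ℕ) + 1 = p then (basicMethod p ct).b i else 0 := by
  have h1 := finProdFinEquiv.symm_apply_apply (a, i)
  simp only [finProdFinEquiv_symm_apply, Prod.mk.injEq] at h1
  simp only [parallelIterated, h1]

variable {E : Type*}

theorem isBigO_pow_pow_of_le {m n : ℕ} (h : m ≤ n) :
    (fun x : ℝ => x ^ n) =O[𝓝 0] fun x : ℝ => x ^ m := by
  rcases h.eq_or_lt with rfl | h
  · exact isBigO_refl _ _
  · exact (isLittleO_pow_pow h).isBigO

theorem parallelIterated_sum_A_smul_zero [AddCommGroup E] [Module ℝ E] (h0 : 0 < p)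
    (i : Fin (p + 1)) (k : Fin (p * (p + 1)) → E) :
    ∑ j, (parallelIterated p ct).A (finProdFinEquiv (⟨0, h0⟩, i)) j • k j = 0 := by
  rw [← finProdFinEquiv.sum_comp]
  exact Finset.sum_eq_zero fun ⟨b, j⟩ _ => by simp [parallelIterated_A_apply]

theorem parallelIterated_sum_A_smul_succ [AddCommGroup E] [Module ℝ E] {l : ℕ} (hl : l + 1 < p)
    (i : Fin (p + 1)) (k : Fin (p * (p + 1)) → E) :
    ∑ j, (parallelIterated p ct).A (finProdFinEquiv (⟨l + 1, hl⟩, i)) j • k j =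
      ∑ j, (basicMethod p ct).A i j • k (finProdFinEquiv (⟨l, by omega⟩, j)) := by
  rw [← finProdFinEquiv.sum_comp, Fintype.sum_prod_type, Finset.sum_eq_single ⟨l, by omega⟩]
  · simp [parallelIterated_A_apply]
  · intro b _ hb
    have : l ≠ (b : ℕ) := fun h => hb (Fin.ext h.symm)
    exact Finset.sum_eq_zero fun j _ => by simp [parallelIterated_A_apply, this]
  · simp

theorem parallelIterated_sum_b_smul [AddCommGroup E] [Module ℝ E] {l : ℕ} (hl : l + 1 = p)
    (k : Fin (p * (p + 1)) → E) :
    ∑ j, (parallelIterated p ct).b j • k j =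
      ∑ j, (basicMethod p ct).b j • k (finProdFinEquiv (⟨l, by omega⟩, j)) := by
  rw [← finProdFinEquiv.sum_comp, Fintype.sum_prod_type, Finset.sum_eq_single ⟨l, by omega⟩]
  · simp [parallelIterated_b_apply, hl]
  · intro b _ hb
    have : (b : ℕ) + 1 ≠ p := fun h => hb (Fin.ext (by simp; omega))
    exact Finset.sum_eq_zero fun j _ => by simp [parallelIterated_b_apply, this]
  · simp

theorem parallelIterated_c_zero (h0 : 0 < p) (i : Fin (p + 1)) :
    (parallelIterated p ct).c (finProdFinEquiv (⟨0, h0⟩, i)) = 0 := by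
  simpa [RKMethod.c] using
    parallelIterated_sum_A_smul_zero (ct := ct) h0 i (fun _ => (1 : ℝ))

theorem parallelIterated_c_succ (hct : Function.Injective ct) {l : ℕ} (hl : l + 1 < p)
    (i : Fin (p + 1)) :
    (parallelIterated p ct).c (finProdFinEquiv (⟨l + 1, hl⟩, i)) = ct i := by
  have h1 := parallelIterated_sum_A_smul_succ (ct := ct) hl i (fun _ => (1 : ℝ))
  have h2 := congrFun (basicMethod_c (by omega) hct) i
  simp only [smul_eq_mul, mul_one] at h1
  exact h1.trans h2

theorem parallelIterated_isExplicit : (parallelIterated p ct).IsExplicit := by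
  intro i j hij
  have h1 : (i.divNat : ℕ) ≤ j.divNat := Nat.div_le_div_right hij
  simp only [parallelIterated, Matrix.of_apply]
  rw [if_neg (by omega)]

/-- The derivatives at the stages of the block number `l` are correct up to `O(h^(l+1))`. -/
theorem isBigO_parallelIterated_stages [NormedAddCommGroup E] [NormedSpace ℝ E]
    (hct : Function.Injective ct)
    {f : ℝ → E → E} {t₀ : ℝ} {y : ℝ → E}
    (hf : ContDiff ℝ ∞ fun z : ℝ × E => f z.1 z.2)
    (hy : ∀ᶠ x in 𝓝 0, HasDerivAt (fun x => y (t₀ + x)) (f (t₀ + x) (y (t₀ + x))) x)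
    (hg : ∀ n : ℕ, ContDiffAt ℝ n (fun x => f (t₀ + x) (y (t₀ + x))) 0)
    {k : ℝ → Fin (p * (p + 1)) → E}
    (hk : ∀ h, (parallelIterated p ct).IsStages f t₀ (y t₀) h (k h)) {l : ℕ} (hl : l < p)
    (i : Fin (p + 1)) :
    (fun h => k h (finProdFinEquiv (⟨l, hl⟩, i)) - f (t₀ + ct i * h) (y (t₀ + ct i * h)))
      =O[𝓝 0] fun h : ℝ => h ^ (l + 1) := by
  have tend : ∀ r : ℝ, Tendsto (fun h : ℝ => r * h) (𝓝 0) (𝓝 0) := fun r => by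
    simpa using (continuous_const_mul r).tendsto 0
  induction l generalizing i with
  | zero =>
    -- Block 0 uses the initial slope, which differs from the slope at `t₀ + ct i * h` by `O(h)`.
    have h1 : ∀ h, k h (finProdFinEquiv (⟨0, hl⟩, i)) = f t₀ (y t₀) := fun h => by
      rw [hk h, parallelIterated_c_zero, parallelIterated_sum_A_smul_zero]
      simp
    obtain ⟨u, hu⟩ : ∃ g', HasDerivAt (fun x => f (t₀ + x) (y (t₀ + x))) g' 0 :=
      ⟨_, ((hg 1).differentiableAt (by simp)).hasDerivAt⟩
    have h2 := hu.isBigO_sub.neg_left.comp_tendsto (tend (ct i))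
    simp only [Function.comp_def, sub_zero, add_zero, neg_sub] at h2
    simp only [h1, zero_add, pow_one]
    exact h2.trans (isBigO_const_mul_self _ _ _)
  | succ l ih =>
    have hl' : l < p := by omega
    have h1 : ∀ h, k h (finProdFinEquiv (⟨l + 1, hl⟩, i)) = f (t₀ + ct i * h)
        (y t₀ + h • ∑ j, (basicMethod p ct).A i j • k h (finProdFinEquiv (⟨l, hl'⟩, j))) :=
      fun h => by
        rw [hk h, parallelIterated_c_succ hct, parallelIterated_sum_A_smul_succ]
    simp only [h1]
    have ht : Tendsto (fun h : ℝ => t₀ + ct i * h) (𝓝 0) (𝓝 t₀) := by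
      simpa using (tend (ct i)).const_add t₀
    have hyc : Tendsto (fun x => y (t₀ + x)) (𝓝 0) (𝓝 (y t₀)) := by
      simpa using hy.self_of_nhds.continuousAt.tendsto
    refine isBigO_rhs_sub (y₀ := y t₀) (hf.of_le (by exact_mod_cast le_top)).contDiffAt ht
      (hyc.comp (tend (ct i))) ?_ ?_
    -- The error of the argument of `f` is the quadrature error `O(h^(p+1))` plus `h` times the
    -- slope errors of the previous block.
    · have hq := isBigO_quadrature hy (hg p) ((basicMethod p ct).A i) ct (ct i)
        (fun m hm => basicMethod_sum_A_mul_pow hct i hm)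
      have hq' := hq.trans (isBigO_pow_pow_of_le (show l + 1 + 1 ≤ p + 1 by omega))
      have hs : (fun h : ℝ => h • ∑ j, (basicMethod p ct).A i j •
          (k h (finProdFinEquiv (⟨l, hl'⟩, j)) - f (t₀ + ct j * h) (y (t₀ + ct j * h))))
          =O[𝓝 0] fun h : ℝ => h ^ (l + 1 + 1) := by
        simp only [pow_succ' _ (l + 1)]
        exact (isBigO_refl (fun h : ℝ => h) _).smul
          (IsBigO.fun_sum fun j _ => (ih hl' j).const_smul_left _)
      refine (hs.sub hq').congr_left fun h => ?_
      simp only [smul_sub, Finset.sum_sub_distrib, add_zero]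
      abel
    · have : Continuous fun h : ℝ => h ^ (l + 1 + 1) := by fun_prop
      simpa using this.tendsto 0

theorem parallelIterated_orderAtLeast (hp : 0 < p) (hct : Function.Injective ct) :
    (parallelIterated p ct).OrderAtLeast p := by
  intro d f t₀ y hf hy
  have hex := parallelIterated_isExplicit (p := p) (ct := ct)
  have hshift : Tendsto (fun x : ℝ => t₀ + x) (𝓝 0) (𝓝 t₀) := by
    simpa using (continuous_const_add t₀).tendsto 0
  have hy' : ∀ᶠ x in 𝓝 0,
      HasDerivAt (fun x => y (t₀ + x)) (f (t₀ + x) (y (t₀ + x))) x := by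
    filter_upwards [hshift.eventually hy] with x hx using hx.comp_const_add t₀ x
  have hg : ∀ n : ℕ, ContDiffAt ℝ n (fun x => f (t₀ + x) (y (t₀ + x))) 0 := fun n => by
    have h1 : ContDiffAt ℝ n (fun x : ℝ => t₀ + x) 0 := by fun_prop
    have h2 : ContDiffAt ℝ n y (t₀ + 0) := by
      simpa using ContDiffAt.of_eventually_hasDerivAt hf hy n
    exact ContDiffAt.comp (g := fun z : ℝ × EuclideanSpace ℝ (Fin d) => f z.1 z.2) 0
      (hf.of_le (by exact_mod_cast le_top)).contDiffAt (h1.prodMk (h2.comp 0 h1))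
  have hstep := fun h => (hex.existsUnique_isStep f t₀ (y t₀) h).exists
  choose Y k hk hY using hstep
  obtain ⟨l, hl⟩ : ∃ l, l + 1 = p := ⟨p - 1, by omega⟩
  have hq := isBigO_quadrature hy' (hg p) (basicMethod p ct).b ct 1
    (fun m hm => by simpa using basicMethod_sum_b_mul_pow hct hm)
  have hs : (fun h : ℝ => h • ∑ j, (basicMethod p ct).b j •
      (k h (finProdFinEquiv (⟨l, by omega⟩, j)) - f (t₀ + ct j * h) (y (t₀ + ct j * h))))
      =O[𝓝 0] fun h : ℝ => h ^ (p + 1) := by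
    simp only [pow_succ' _ p]
    refine (isBigO_refl (fun h : ℝ => h) _).smul (IsBigO.fun_sum fun j _ => ?_)
    have := isBigO_parallelIterated_stages hct hf hy' hg hk (l := l) (by omega) j
    rw [hl] at this
    exact this.const_smul_left ((basicMethod p ct).b j)
  have hmain : (fun h => y (t₀ + h) - Y h) =O[𝓝 0] fun h : ℝ => h ^ (p + 1) := by
    refine (hq.sub hs).congr_left fun h => ?_
    rw [hY h, parallelIterated_sum_b_smul hl]
    simp only [smul_sub, Finset.sum_sub_distrib, add_zero, one_mul]
    abel
  obtain ⟨C, hC⟩ := hmain.bound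
  obtain ⟨h₀, hh₀, H⟩ := Metric.eventually_nhds_iff.mp hC
  refine ⟨C, h₀, hh₀, fun h h1 h2 y₁ hy₁ => ?_⟩
  rw [(hex.existsUnique_isStep f t₀ (y t₀) h).unique hy₁ ⟨k h, hk h, hY h⟩]
  have := H (y := h) (by simpa [abs_of_pos h1] using h2)
  rwa [Real.norm_of_nonneg (by positivity)] at this

theorem parallelIterated_mulVec_zero (h0 : 0 < p) (i : Fin (p + 1))
    (v : Fin (p * (p + 1)) → ℝ) :
    ((parallelIterated p ct).A *ᵥ v) (finProdFinEquiv (⟨0, h0⟩, i)) = 0 :=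
  parallelIterated_sum_A_smul_zero h0 i v

theorem parallelIterated_mulVec_succ {l : ℕ} (hl : l + 1 < p) (i : Fin (p + 1))
    (v : Fin (p * (p + 1)) → ℝ) :
    ((parallelIterated p ct).A *ᵥ v) (finProdFinEquiv (⟨l + 1, hl⟩, i)) =
      ((basicMethod p ct).A *ᵥ fun j => v (finProdFinEquiv (⟨l, by omega⟩, j))) i :=
  parallelIterated_sum_A_smul_succ hl i v

theorem parallelIterated_b_dotProduct {l : ℕ} (hl : l + 1 = p) (v : Fin (p * (p + 1)) → ℝ) :
    (parallelIterated p ct).b ⬝ᵥ v =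
      (basicMethod p ct).b ⬝ᵥ fun j => v (finProdFinEquiv (⟨l, by omega⟩, j)) :=
  parallelIterated_sum_b_smul hl v

theorem RKMethod.tau_one {s : ℕ} (M : RKMethod s) : M.tau 1 = 0 := by
  funext i
  simp [RKMethod.tau, RKMethod.c, Matrix.mulVec, dotProduct]

/-- The residual `τ⁽ᵏ⁾` with `2 ≤ k ≤ p` lives in the block number `1`. -/
theorem parallelIterated_tau (hct : Function.Injective ct) {k : ℕ} (hk : 2 ≤ k) (hkp : k ≤ p)
    (l : Fin p) (i : Fin (p + 1)) :
    (parallelIterated p ct).tau k (finProdFinEquiv (l, i)) =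
      if (l : ℕ) = 1 then -(1 / (k : ℝ)) * ct i ^ k else 0 := by
  obtain ⟨l, hl⟩ := l
  simp only [RKMethod.tau, Pi.sub_apply, Pi.smul_apply, Pi.pow_apply, smul_eq_mul]
  match l with
  | 0 =>
    rw [parallelIterated_mulVec_zero, parallelIterated_c_zero]
    simp
    omega
  | 1 =>
    rw [parallelIterated_mulVec_succ, parallelIterated_c_succ hct]
    -- The block feeding block 1 has zero abscissas and `k - 1 ≥ 1`, so nothing cancels `-c̃^k/k`
    -- here. In later blocks `Ã` integrates `c̃^(k-1)` exactly.
    simp only [Pi.pow_apply, parallelIterated_c_zero, zero_pow (show k - 1 ≠ 0 by omega)]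
    have : (fun _ : Fin (p + 1) => (0 : ℝ)) = 0 := rfl
    simp [this]
  | l + 2 =>
    rw [parallelIterated_mulVec_succ, parallelIterated_c_succ hct]
    simp only [Pi.pow_apply, parallelIterated_c_succ hct]
    have h1 := congrFun (basicMethod_A_mulVec_pow hct (show k - 1 < p by omega)) i
    have h2 : ((k - 1 : ℕ) : ℝ) + 1 = k := by
      exact_mod_cast Nat.sub_add_cancel (show 1 ≤ k by omega)
    rw [h2, Nat.sub_add_cancel (show 1 ≤ k by omega)] at h1
    have h3 : (fun j => ct j ^ (k - 1)) = ct ^ (k - 1) := rfl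
    rw [h3, h1]
    simp

theorem parallelIterated_pow_mulVec_tau (hct : Function.Injective ct) {k : ℕ} (hk : 2 ≤ k)
    (hkp : k ≤ p) (n : ℕ) (l : Fin p) (i : Fin (p + 1)) :
    ((parallelIterated p ct).A ^ n *ᵥ (parallelIterated p ct).tau k) (finProdFinEquiv (l, i)) =
      if (l : ℕ) = n + 1 then -(1 / (k : ℝ)) * ((basicMethod p ct).A ^ n *ᵥ ct ^ k) i else 0 := by
  induction n generalizing l i with
  | zero => simpa using parallelIterated_tau hct hk hkp l i
  | succ n ih =>
    obtain ⟨l, hl⟩ := l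
    rw [pow_succ', ← Matrix.mulVec_mulVec]
    match l with
    | 0 => simp [parallelIterated_mulVec_zero]
    | l + 1 =>
      rw [parallelIterated_mulVec_succ]
      simp only [ih, pow_succ' _ n, ← Matrix.mulVec_mulVec]
      by_cases h : l = n + 1
      · simp only [h, if_true]
        exact congrFun (Matrix.mulVec_smul (basicMethod p ct).A (-(1 / (k : ℝ)))
          ((basicMethod p ct).A ^ n *ᵥ ct ^ k)) i
      · have h0 : (fun _ : Fin (p + 1) => (0 : ℝ)) = 0 := rfl
        simp [h, h0]

theorem parallelIterated_b_dotProduct_pow_mulVec_tau (hct : Function.Injective ct)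
    (n : ℕ) {k : ℕ} (hk : 1 ≤ k) (hkp : k ≤ p) :
    (parallelIterated p ct).b ⬝ᵥ ((parallelIterated p ct).A ^ n *ᵥ (parallelIterated p ct).tau k)
      = 0 := by
  rcases hk.eq_or_lt with rfl | hk
  · simp [RKMethod.tau_one]
  obtain ⟨l, hl⟩ : ∃ l, l + 1 = p := ⟨p - 1, by omega⟩
  rw [parallelIterated_b_dotProduct hl]
  simp only [parallelIterated_pow_mulVec_tau hct hk hkp]
  by_cases h : l = n + 1
  · simp only [h, if_true]
    -- Here `n = p - 2`, so `k ≥ 2` is just what yields `p ≤ n + k`.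
    have h1 := basicMethod_b_dotProduct_pow_mulVec hct (n := n) hkp (by omega)
    have h2 := dotProduct_smul (-(1 / (k : ℝ))) (basicMethod p ct).b
      ((basicMethod p ct).A ^ n *ᵥ ct ^ k)
    rw [h1, smul_zero] at h2
    exact h2
  · simp only [h, if_false]
    exact dotProduct_zero _

theorem parallelIterated_b_dotProduct_c_pow (hp : 2 ≤ p) (hct : Function.Injective ct) (m : ℕ) :
    (parallelIterated p ct).b ⬝ᵥ (parallelIterated p ct).c ^ m =
      ∑ j, (basicMethod p ct).b j * ct j ^ m := by
  obtain ⟨l, rfl⟩ : ∃ l, p = l + 2 := ⟨p - 2, by omega⟩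
  rw [parallelIterated_b_dotProduct (l := l + 1) rfl]
  simp only [Pi.pow_apply, parallelIterated_c_succ hct]
  rfl

theorem parallelIterated_b_dotProduct_tau_succ (hp : 2 ≤ p) (hct : Function.Injective ct) :
    (parallelIterated p ct).b ⬝ᵥ (parallelIterated p ct).tau (p + 1) =
      -(1 / ((p : ℝ) + 1)) * ∑ j, (basicMethod p ct).b j * ct j ^ (p + 1) := by
  have h0 : (parallelIterated p ct).b ⬝ᵥ
      ((parallelIterated p ct).A *ᵥ (parallelIterated p ct).c ^ p) = 0 := by
    obtain ⟨l, hl⟩ : ∃ l, p = l + 2 := ⟨p - 2, by omega⟩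
    rw [parallelIterated_b_dotProduct (l := l + 1) hl.symm]
    simp only [parallelIterated_mulVec_succ]
    have h1 : (basicMethod p ct).A *ᵥ (fun j => ((parallelIterated p ct).c ^ p)
        (finProdFinEquiv (⟨l, by omega⟩, j))) = 0 := by
      -- For `p = 2` the block before the last is block 0, with zero abscissas; otherwise its
      -- abscissas are `ct`, and `Ã` kills `ct ^ p`.
      rcases l with _ | l
      · simp only [Pi.pow_apply, parallelIterated_c_zero, zero_pow (show p ≠ 0 by omega)]
        exact Matrix.mulVec_zero _
      · simp only [Pi.pow_apply, parallelIterated_c_succ hct]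
        exact basicMethod_A_mulVec_pow_last hct
    rw [h1]
    exact dotProduct_zero _
  rw [RKMethod.tau, dotProduct_sub, Nat.add_sub_cancel, h0, dotProduct_smul,
    parallelIterated_b_dotProduct_c_pow hp hct]
  simp

end Parallel

/-! ### The consolidated method. -/

section Reduced

variable {p : ℕ} {ct : Fin (p + 1) → ℝ}

theorem consolidate_representative (i : Fin (p ^ 2)) : consolidate p (representative p i) = i :=
  Fin.ext (by simp [consolidate, representative])

theorem parallelIterated_isReduction :
    (parallelIterated p ct).IsReduction (consolidate p) (reducedMethod p ct) := by
  refine ⟨fun i => ⟨_, consolidate_representative i⟩, fun i m => ?_, fun m => rfl⟩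
  simp only [reducedMethod, Matrix.of_apply]
  refine Finset.sum_congr rfl fun j _ => ?_
  -- A stage `i ≥ p` is its own representative. A stage `i < p` lies in block 0 together with its
  -- representative `p`, and both rows are zero.
  rcases le_or_gt p i with hi | hi
  · congr 1
    exact Fin.ext (by simp [representative, consolidate]; omega)
  · have h1 : (i.divNat : ℕ) = 0 := Nat.div_eq_of_lt (by omega)
    have h2 : ((representative p (consolidate p i)).divNat : ℕ) = 0 :=
      Nat.div_eq_of_lt (by simp [representative, consolidate]; omega)
    simp only [parallelIterated, Matrix.of_apply]
    rw [if_neg (by omega), if_neg (by omega)]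

theorem reducedMethod_isExplicit : (reducedMethod p ct).IsExplicit := by
  intro i m him
  simp only [reducedMethod, Matrix.of_apply]
  refine Finset.sum_eq_zero fun j hj => ?_
  have hjm : (j : ℕ) - p = m := congrArg Fin.val (Finset.mem_filter.mp hj).2
  have him' : (i : ℕ) ≤ m := him
  have h1 : ((representative p i).divNat : ℕ) ≤ j.divNat := by
    change ((i : ℕ) + p) / (p + 1) ≤ j / (p + 1)
    -- If `j < p`, truncated subtraction gives `m = 0`, hence `i = 0`, whose representative `p`
    -- still lies in block 0.
    rcases le_or_gt p j with h | h
    · exact Nat.div_le_div_right (by omega)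
    · rw [Nat.div_eq_of_lt (show (i : ℕ) + p < p + 1 by omega)]
      exact Nat.zero_le _
  simp only [parallelIterated, Matrix.of_apply]
  rw [if_neg (by omega)]

theorem reducedMethod_hasOrder (hp : 2 ≤ p) (hct : Function.Injective ct) :
    (reducedMethod p ct).HasOrder p := by
  have hR := parallelIterated_isReduction (p := p) (ct := ct)
  refine ⟨hR.orderAtLeast (parallelIterated_orderAtLeast (by omega) hct), fun n hn => ?_⟩
  by_contra hlt
  -- A higher order would force `bᵀ c^p = 1/(p+1)`, but this moment is zero.
  have h1 := RKMethod.OrderAtLeast.sum_b_mul_c_pow hn reducedMethod_isExplicit (not_le.mp hlt)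
  have h2 := hR.b_dotProduct ((reducedMethod p ct).c ^ p)
  have h3 : ((reducedMethod p ct).c ^ p) ∘ consolidate p = (parallelIterated p ct).c ^ p := by
    rw [← hR.c_comp]
    rfl
  rw [h3, parallelIterated_b_dotProduct_c_pow hp hct, basicMethod_sum_b_mul_pow_last hct] at h2
  simp only [dotProduct, Pi.pow_apply] at h2
  rw [h2] at h1
  have : 0 < 1 / ((p : ℝ) + 1) := by positivity
  exact this.ne h1

theorem reducedMethod_wsoAtLeast (hp : 0 < p) (hct : Function.Injective ct) :
    (reducedMethod p ct).WSOAtLeast p := by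
  have hR := parallelIterated_isReduction (p := p) (ct := ct)
  refine RKMethod.wsoAtLeast_of_forall hp fun n k hk hkp => ?_
  rw [hR.b_dotProduct, hR.pow_mulVec_comp, hR.tau_comp]
  exact parallelIterated_b_dotProduct_pow_mulVec_tau hct n hk hkp

theorem reducedMethod_hasWSO (hp : 2 ≤ p) (hct : Function.Injective ct)
    (hne : ∑ j, (basicMethod p ct).b j * ct j ^ (p + 1) ≠ 0) :
    (reducedMethod p ct).HasWSO p := by
  refine ⟨reducedMethod_wsoAtLeast (by omega) hct, fun n hn => ?_⟩
  by_contra hlt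
  have h1 := RKMethod.WSOAtLeast.b_dotProduct_tau hn (by positivity) (Nat.le_add_left 1 p)
    (by omega)
  have hR := parallelIterated_isReduction (p := p) (ct := ct)
  rw [hR.b_dotProduct, hR.tau_comp, parallelIterated_b_dotProduct_tau_succ hp hct] at h1
  have h2 : (p : ℝ) + 1 ≠ 0 := by positivity
  simp [h2, hne] at h1

end Reduced

theorem theorem3p1 (p : ℕ) (hp : 2 ≤ p) :
    (∃ ct : Fin (p + 1) → ℝ, Function.Injective ct ∧
      (reducedMethod p ct).IsExplicit ∧
      (reducedMethod p ct).HasOrder p ∧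
      (reducedMethod p ct).HasWSO p) ∧
    ∀ ct : Fin (p + 1) → ℝ, Function.Injective ct →
      (basicMethod p ct).c = ct ∧
      (parallelIterated p ct).IsReduction (consolidate p) (reducedMethod p ct) ∧
      (reducedMethod p ct).IsExplicit ∧
      (reducedMethod p ct).HasOrder p ∧
      (reducedMethod p ct).WSOAtLeast p := by
  refine ⟨?_, fun ct hct => ⟨basicMethod_c (by omega) hct, parallelIterated_isReduction,
    reducedMethod_isExplicit, reducedMethod_hasOrder hp hct,
    reducedMethod_wsoAtLeast (by omega) hct⟩⟩
  obtain ⟨ct, hct, hne⟩ := exists_basicMethod_sum_b_mul_pow_ne_zero (p := p) (by omega)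
  exact ⟨ct, hct, reducedMethod_isExplicit, reducedMethod_hasOrder hp hct,
    reducedMethod_hasWSO hp hct hne⟩
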